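/- Call a probability density function $g$ on $\mathbb{R}$ \emph{sum-bounded} if there exist positive constants $c_l, c_u$ such that for every integer $k\ge 1$, the density $g_k$ of the sum of $k$ independent random variables with density $g$ satisfies $g_k(x)\ge c_l/\sqrt{k}$ for all $x\in[-\sqrt{k},\sqrt{k}]$ and $g_k(x)\le c_u/\sqrt{k}$ for all $x\in\mathbb{R}$. Here $g_k$ is the version of the density given at every point by the convolutions $g_1=g$ and $g_{k+1}(x)=\int_{\mathbb{R}} g_k(x-\tau)\,g(\tau)\,d\tau$. The Uniform$[-1,1]$ probability density function, equal to $\tfrac12$ on $[-1,1]$ and to $0$ elsewhere, is sum-bounded. That is, there exist constants $c_l>0$ and $c_u>0$ such that for every integer $n\ge 1$, the density $f(\cdot,n)$ of the sum $U_1+\dots+U_n$ of $n$ i.i.d. Uniform$[-1,1]$ random variables (in the version given by these convolutions) satisfies $$\frac{c_l}{\sqrt{n}}\le f(x,n)\ \text{ for all } x\in[-\sqrt{n},\sqrt{n}],\qquad f(x,n)\le\frac{c_u}{\sqrt{n}}\ \text{ for all } x\in\mathbb{R}.$$ -/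

import Mathlib

open MeasureTheory ProbabilityTheory

universe u

/-- `f` is a probability density function on the real line (with respect to Lebesgue measure). -/
structure IsProbDensity (f : ℝ → ℝ) : Prop where
  measurable : Measurable f
  nonneg : ∀ x, 0 ≤ f x
  lintegral_eq_one : ∫⁻ x, ENNReal.ofReal (f x) = 1

/-- The real random variable `Y` on `(Ω, P)` has the probability density function `g`. -/
structure HasDensity {Ω : Type u} [MeasurableSpace Ω] (P : Measure Ω) (Y : Ω → ℝ) (g : ℝ → ℝ) :
    Prop where
  measurable : Measurable Y
  isProbDensity : IsProbDensity g
  map_eq : P.map Y = volume.withDensity (fun x => ENNReal.ofReal (g x))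

/-- The density `x ↦ f(x, k)` of the sum of `k ≥ 1` independent variables with density `f`, as the
function given at every point by `f(x, 1) = f(x)` and
`f(x, k + 1) = ∫ f(x - τ, k) f(τ) dτ` (the value at `k = 0` is a placeholder that is never used). -/
noncomputable def sumDensity (f : ℝ → ℝ) : ℕ → ℝ → ℝ
  | 0 => fun _ => 0
  | 1 => f
  | k + 2 => fun x => ∫ τ, sumDensity f (k + 1) (x - τ) * f τ

/-- A probability density function `f` is sum-bounded if there are positive constants `cl`, `cu`
such that for every `k ≥ 1`, and for `k` independent samples with density `f`, the density of their
sum is at least `cl / √k` at every point of `[-√k, √k]` and at most `cu / √k` at every point of `ℝ`.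
The two bounds are unconditional; the last clause says that the function which they bound is
the density of the sum, whatever the probability space and the samples are. -/
def IsSumBounded (f : ℝ → ℝ) : Prop :=
  IsProbDensity f ∧
  ∃ cl cu : ℝ, 0 < cl ∧ 0 < cu ∧ ∀ k : ℕ, 1 ≤ k →
    (∀ x ∈ Set.Icc (-√(k : ℝ)) (√(k : ℝ)), cl / √(k : ℝ) ≤ sumDensity f k x) ∧
    (∀ x : ℝ, sumDensity f k x ≤ cu / √(k : ℝ)) ∧
    (∀ (Ω : Type u) [MeasurableSpace Ω] (P : Measure Ω) [IsProbabilityMeasure P]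
      (X : Fin k → Ω → ℝ), iIndepFun X P → (∀ i, HasDensity P (X i) f) →
        HasDensity P (fun ω => ∑ i, X i ω) (sumDensity f k))

/-- The Uniform`[-1, 1]` probability density function: `1/2` on `[-1, 1]` and `0` elsewhere. -/
noncomputable def uniformDensity : ℝ → ℝ :=
  (Set.Icc (-1 : ℝ) 1).indicator (fun _ => 1 / 2)

/-! Upper bound: a uniform variable is half the sum of a uniform variable and an independent random
sign. Hence the density of the `n`-fold sum at `x` is at most a binomially weighted sum of its own
values along a progression of step two (`sumDensity_uniformDensity_le_sum_choose`). The weights are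
at most `2 ^ n / √n` (`choose_mul_sqrt_le`). The unweighted sum is at most `1 / 2`, because each
term is half the integral of the previous density over one of a row of adjacent windows. This gives
`cu = 1`.

Lower bound: by the central limit theorem, the sum lies in `(√n, 2√n)` with probability eventually
bounded below. By unimodality (`sumDensity_uniformDensity_le_of_abs_le`) that probability is at most
`√n` times the density at `√n`. Positivity at `√n` covers the finitely many remaining `n`, and
unimodality extends the bound to `[-√n, √n]`. -/

lemma uniformDensity_nonneg (x : ℝ) : 0 ≤ uniformDensity x :=
  Set.indicator_nonneg (fun _ _ => by norm_num) x

lemma uniformDensity_le_half (x : ℝ) : uniformDensity x ≤ 1 / 2 :=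
  Set.indicator_le_self' (fun _ _ => by norm_num) x

lemma uniformDensity_of_mem {x : ℝ} (hx : x ∈ Set.Icc (-1 : ℝ) 1) : uniformDensity x = 1 / 2 :=
  Set.indicator_of_mem hx _

lemma uniformDensity_of_notMem {x : ℝ} (hx : x ∉ Set.Icc (-1 : ℝ) 1) : uniformDensity x = 0 :=
  Set.indicator_of_notMem hx _

lemma measurable_uniformDensity : Measurable uniformDensity :=
  measurable_const.indicator measurableSet_Icc

lemma integrable_uniformDensity : Integrable uniformDensity := by
  rw [uniformDensity, integrable_indicator_iff measurableSet_Icc]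
  exact integrableOn_const (by simp)

lemma ofReal_uniformDensity :
    (fun x => ENNReal.ofReal (uniformDensity x)) =
      (Set.Icc (-1 : ℝ) 1).indicator (fun _ => (2 : ENNReal)⁻¹) := by
  funext x
  by_cases hx : x ∈ Set.Icc (-1 : ℝ) 1
  · rw [uniformDensity_of_mem hx, Set.indicator_of_mem hx, one_div,
      ENNReal.ofReal_inv_of_pos two_pos, ENNReal.ofReal_ofNat]
  · rw [uniformDensity_of_notMem hx, Set.indicator_of_notMem hx, ENNReal.ofReal_zero]

lemma withDensity_uniformDensity :
    volume.withDensity (fun x => ENNReal.ofReal (uniformDensity x)) =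
      ProbabilityTheory.cond volume (Set.Icc (-1 : ℝ) 1) := by
  rw [ofReal_uniformDensity, withDensity_indicator measurableSet_Icc, withDensity_const,
    ProbabilityTheory.cond, Real.volume_Icc]
  norm_num

lemma isProbDensity_uniformDensity : IsProbDensity uniformDensity where
  measurable := measurable_uniformDensity
  nonneg := uniformDensity_nonneg
  lintegral_eq_one := by
    rw [ofReal_uniformDensity, lintegral_indicator measurableSet_Icc, setLIntegral_const,
      Real.volume_Icc]
    norm_num
    exact ENNReal.inv_mul_cancel (by simp) (by simp)

/-! ### Convolution powers: bounds, measurability, total mass -/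

/-- Convolving with the uniform density averages over a window of length two. -/
lemma sumDensity_uniformDensity_succ (n : ℕ) (x : ℝ) :
    sumDensity uniformDensity (n + 2) x =
      (1 / 2) * ∫ t in (x - 1)..(x + 1), sumDensity uniformDensity (n + 1) t := by
  have h : ∀ τ, sumDensity uniformDensity (n + 1) (x - τ) * uniformDensity τ =
      (Set.Icc (-1 : ℝ) 1).indicator
        (fun τ => sumDensity uniformDensity (n + 1) (x - τ) * (1 / 2)) τ := by
    intro τ
    by_cases hτ : τ ∈ Set.Icc (-1 : ℝ) 1
    · rw [uniformDensity_of_mem hτ, Set.indicator_of_mem hτ]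
    · rw [uniformDensity_of_notMem hτ, Set.indicator_of_notMem hτ, mul_zero]
  calc sumDensity uniformDensity (n + 2) x
      = ∫ τ, sumDensity uniformDensity (n + 1) (x - τ) * uniformDensity τ := rfl
    _ = ∫ τ in (-1 : ℝ)..1, sumDensity uniformDensity (n + 1) (x - τ) * (1 / 2) := by
      simp_rw [h]
      rw [integral_indicator measurableSet_Icc, integral_Icc_eq_integral_Ioc,
        intervalIntegral.integral_of_le (by norm_num)]
    _ = _ := by
      rw [intervalIntegral.integral_mul_const,
        intervalIntegral.integral_comp_sub_left (fun t => sumDensity uniformDensity (n + 1) t) x,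
        sub_neg_eq_add, mul_comm]

lemma sumDensity_uniformDensity_nonneg (n : ℕ) (x : ℝ) :
    0 ≤ sumDensity uniformDensity (n + 1) x := by
  induction n generalizing x with
  | zero => exact uniformDensity_nonneg x
  | succ n ih => exact integral_nonneg fun τ => mul_nonneg (ih _) (uniformDensity_nonneg τ)

/-- An average of values at most `1 / 2` is at most `1 / 2`. Measurability is not yet available, so
the proof uses a norm estimate that needs no integrability; the bound then makes the convolution
integrand integrable. -/
lemma sumDensity_uniformDensity_le_half (n : ℕ) (x : ℝ) :
    sumDensity uniformDensity (n + 1) x ≤ 1 / 2 := by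
  cases n with
  | zero => exact uniformDensity_le_half x
  | succ n =>
    induction n generalizing x with
    | zero =>
      rw [sumDensity_uniformDensity_succ]
      have := intervalIntegral.norm_integral_le_of_norm_le_const (a := x - 1) (b := x + 1)
        (f := sumDensity uniformDensity 1) (C := 1 / 2) fun t _ => by
          rw [Real.norm_of_nonneg (sumDensity_uniformDensity_nonneg 0 t)]
          exact uniformDensity_le_half t
      have h := (Real.le_norm_self _).trans this
      norm_num at h ⊢
      linarith
    | succ n ih =>
      rw [sumDensity_uniformDensity_succ]
      have := intervalIntegral.norm_integral_le_of_norm_le_const (a := x - 1) (b := x + 1)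
        (f := sumDensity uniformDensity (n + 2)) (C := 1 / 2) fun t _ => by
          rw [Real.norm_of_nonneg (sumDensity_uniformDensity_nonneg (n + 1) t)]
          exact ih t
      have h := (Real.le_norm_self _).trans this
      norm_num at h ⊢
      linarith

lemma ofReal_sumDensity_uniformDensity_succ (n : ℕ)
    (hm : Measurable (sumDensity uniformDensity (n + 1))) :
    (fun x => ENNReal.ofReal (sumDensity uniformDensity (n + 2) x)) =
      lconvolution (fun x => ENNReal.ofReal (uniformDensity x))
        (fun x => ENNReal.ofReal (sumDensity uniformDensity (n + 1) x)) volume := by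
  funext x
  change ENNReal.ofReal (∫ τ, sumDensity uniformDensity (n + 1) (x - τ) * uniformDensity τ) = _
  rw [ofReal_integral_eq_lintegral_ofReal, lconvolution_def]
  · refine lintegral_congr fun τ => ?_
    rw [ENNReal.ofReal_mul (sumDensity_uniformDensity_nonneg n _), mul_comm, neg_add_eq_sub]
  · refine integrable_uniformDensity.bdd_mul (c := 1 / 2)
      (hm.comp (measurable_const.sub measurable_id)).aestronglyMeasurable ?_
    refine Filter.Eventually.of_forall fun τ => ?_
    rw [Real.norm_of_nonneg (sumDensity_uniformDensity_nonneg n _)]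
    exact sumDensity_uniformDensity_le_half n _
  · exact Filter.Eventually.of_forall fun τ =>
      mul_nonneg (sumDensity_uniformDensity_nonneg n _) (uniformDensity_nonneg τ)

lemma measurable_sumDensity_uniformDensity (n : ℕ) :
    Measurable (sumDensity uniformDensity (n + 1)) := by
  induction n with
  | zero => exact measurable_uniformDensity
  | succ n ih =>
    -- Nonnegativity allows a detour through `ENNReal`, where measurability of a convolution is
    -- `measurable_lconvolution`.
    have h : sumDensity uniformDensity (n + 2) =
        fun x => (ENNReal.ofReal (sumDensity uniformDensity (n + 2) x)).toReal := by
      funext x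
      rw [ENNReal.toReal_ofReal (sumDensity_uniformDensity_nonneg (n + 1) x)]
    rw [h]
    refine Measurable.ennreal_toReal ?_
    rw [ofReal_sumDensity_uniformDensity_succ n ih]
    exact measurable_lconvolution _ measurable_uniformDensity.ennreal_ofReal ih.ennreal_ofReal

lemma withDensity_sumDensity_uniformDensity_succ (n : ℕ) :
    volume.withDensity (fun x => ENNReal.ofReal (sumDensity uniformDensity (n + 2) x)) =
      (volume.withDensity (fun x => ENNReal.ofReal (uniformDensity x))).conv
        (volume.withDensity (fun x => ENNReal.ofReal (sumDensity uniformDensity (n + 1) x))) := by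
  rw [ofReal_sumDensity_uniformDensity_succ n (measurable_sumDensity_uniformDensity n),
    conv_withDensity_eq_lconvolution measurable_uniformDensity.ennreal_ofReal
      (measurable_sumDensity_uniformDensity n).ennreal_ofReal]

lemma IsProbDensity.isProbabilityMeasure {f : ℝ → ℝ} (hf : IsProbDensity f) :
    IsProbabilityMeasure (volume.withDensity (fun x => ENNReal.ofReal (f x))) :=
  ⟨by rw [withDensity_apply _ MeasurableSet.univ, setLIntegral_univ, hf.lintegral_eq_one]⟩

lemma isProbDensity_sumDensity_uniformDensity (n : ℕ) :
    IsProbDensity (sumDensity uniformDensity (n + 1)) := by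
  refine ⟨measurable_sumDensity_uniformDensity n, sumDensity_uniformDensity_nonneg n, ?_⟩
  induction n with
  | zero => exact isProbDensity_uniformDensity.lintegral_eq_one
  | succ n ih =>
    have h1 := isProbDensity_uniformDensity.isProbabilityMeasure
    have h2 : IsProbabilityMeasure
        (volume.withDensity (fun x => ENNReal.ofReal (sumDensity uniformDensity (n + 1) x))) :=
      IsProbDensity.isProbabilityMeasure
        ⟨measurable_sumDensity_uniformDensity n, sumDensity_uniformDensity_nonneg n, ih⟩
    rw [← setLIntegral_univ, ← withDensity_apply _ MeasurableSet.univ,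
      withDensity_sumDensity_uniformDensity_succ]
    exact measure_univ

lemma integrable_sumDensity_uniformDensity (n : ℕ) :
    Integrable (sumDensity uniformDensity (n + 1)) := by
  refine ⟨(measurable_sumDensity_uniformDensity n).aestronglyMeasurable, ?_⟩
  rw [hasFiniteIntegral_iff_ofReal
    (Filter.Eventually.of_forall (sumDensity_uniformDensity_nonneg n)),
    (isProbDensity_sumDensity_uniformDensity n).lintegral_eq_one]
  exact ENNReal.one_lt_top

lemma integral_sumDensity_uniformDensity (n : ℕ) :
    ∫ x, sumDensity uniformDensity (n + 1) x = 1 := by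
  rw [integral_eq_lintegral_of_nonneg_ae
    (Filter.Eventually.of_forall (sumDensity_uniformDensity_nonneg n))
    (measurable_sumDensity_uniformDensity n).aestronglyMeasurable,
    (isProbDensity_sumDensity_uniformDensity n).lintegral_eq_one, ENNReal.toReal_one]

/-! ### Symmetry, unimodality and positivity -/

lemma sumDensity_uniformDensity_neg (n : ℕ) (x : ℝ) :
    sumDensity uniformDensity (n + 1) (-x) = sumDensity uniformDensity (n + 1) x := by
  induction n generalizing x with
  | zero =>
    change uniformDensity (-x) = uniformDensity x
    by_cases hx : x ∈ Set.Icc (-1 : ℝ) 1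
    · rw [uniformDensity_of_mem hx, uniformDensity_of_mem ⟨by linarith [hx.2], by linarith [hx.1]⟩]
    · rw [uniformDensity_of_notMem hx, uniformDensity_of_notMem fun h =>
        hx ⟨by linarith [h.2], by linarith [h.1]⟩]
  | succ n ih =>
    rw [sumDensity_uniformDensity_succ, sumDensity_uniformDensity_succ]
    have h := intervalIntegral.integral_comp_neg (a := -x - 1) (b := -x + 1)
      (fun t => sumDensity uniformDensity (n + 1) t)
    simp only [ih] at h
    rw [h]
    congr 2 <;> ring

lemma sumDensity_uniformDensity_abs (n : ℕ) (x : ℝ) :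
    sumDensity uniformDensity (n + 1) |x| = sumDensity uniformDensity (n + 1) x := by
  rcases abs_choice x with h | h <;> rw [h]
  exact sumDensity_uniformDensity_neg n x

/-- The densities are unimodal: they decrease in the distance from the origin. -/
lemma sumDensity_uniformDensity_le_of_abs_le (n : ℕ) {x y : ℝ} (hxy : |x| ≤ |y|) :
    sumDensity uniformDensity (n + 1) y ≤ sumDensity uniformDensity (n + 1) x := by
  induction n generalizing x y with
  | zero =>
    change uniformDensity y ≤ uniformDensity x
    by_cases hx : x ∈ Set.Icc (-1 : ℝ) 1
    · rw [uniformDensity_of_mem hx]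
      exact uniformDensity_le_half y
    · rw [uniformDensity_of_notMem hx, uniformDensity_of_notMem fun h =>
        hx (abs_le.1 (hxy.trans (abs_le.2 h)))]
  | succ n ih =>
    rw [← sumDensity_uniformDensity_abs (n + 1) x, ← sumDensity_uniformDensity_abs (n + 1) y]
    have ha := abs_nonneg x
    generalize |x| = a at *
    generalize |y| = b at *
    rw [sumDensity_uniformDensity_succ, sumDensity_uniformDensity_succ]
    refine mul_le_mul_of_nonneg_left ?_ (by norm_num)
    have hi : ∀ p q, IntervalIntegrable (sumDensity uniformDensity (n + 1)) volume p q :=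
      fun p q => (integrable_sumDensity_uniformDensity n).intervalIntegrable
    -- Sliding the window from `a` to `b` trades `[a - 1, b - 1]` for `[a + 1, b + 1]`, whose points
    -- `t + 1` are farther from the origin than `t - 1`.
    have hl := intervalIntegral.integral_comp_sub_right (a := a) (b := b)
      (sumDensity uniformDensity (n + 1)) 1
    have hr := intervalIntegral.integral_comp_add_right (a := a) (b := b)
      (sumDensity uniformDensity (n + 1)) 1
    have hmono : ∫ t in a..b, sumDensity uniformDensity (n + 1) (t + 1) ≤
        ∫ t in a..b, sumDensity uniformDensity (n + 1) (t - 1) := by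
      refine intervalIntegral.integral_mono_on hxy ?_ ?_ fun t ht => ih ?_
      · exact ((integrable_sumDensity_uniformDensity n).comp_add_right 1).intervalIntegrable
      · exact ((integrable_sumDensity_uniformDensity n).comp_sub_right 1).intervalIntegrable
      · rw [abs_of_nonneg (by linarith [ht.1] : 0 ≤ t + 1), abs_le]
        constructor <;> linarith [ht.1]
    have e1 := intervalIntegral.integral_add_adjacent_intervals (hi (a - 1) (b - 1))
      (hi (b - 1) (b + 1))
    have e2 := intervalIntegral.integral_add_adjacent_intervals (hi (a - 1) (a + 1))
      (hi (a + 1) (b + 1))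
    linarith

lemma sumDensity_uniformDensity_pos (n : ℕ) {x : ℝ} (hx : |x| < n + 1) :
    0 < sumDensity uniformDensity (n + 1) x := by
  induction n generalizing x with
  | zero =>
    change 0 < uniformDensity x
    rw [uniformDensity_of_mem (abs_le.1 (by simpa using hx.le))]
    norm_num
  | succ n ih =>
    rw [← sumDensity_uniformDensity_abs]
    have ha := abs_nonneg x
    generalize |x| = a at *
    have hi : ∀ p q, IntervalIntegrable (sumDensity uniformDensity (n + 1)) volume p q :=
      fun p q => (integrable_sumDensity_uniformDensity n).intervalIntegrable
    have hn : (0 : ℝ) ≤ n := n.cast_nonneg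
    push_cast at hx
    -- The induction hypothesis gives positivity only below `n + 1`, so the window is cut there; `a
    -- < n + 2` keeps the piece nonempty.
    have hlt : a - 1 < min (a + 1) (n + 1) := lt_min (by linarith) (by linarith)
    have hpos : 0 < ∫ t in (a - 1)..(min (a + 1) (n + 1)), sumDensity uniformDensity (n + 1) t := by
      refine intervalIntegral.intervalIntegral_pos_of_pos_on (hi _ _) (fun t ht => ih ?_) hlt
      have := lt_min_iff.1 ht.2
      rw [abs_lt]
      constructor <;> linarith [ht.1]
    have hle : 0 ≤ ∫ t in (min (a + 1) (n + 1))..(a + 1), sumDensity uniformDensity (n + 1) t :=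
      intervalIntegral.integral_nonneg (min_le_left _ _)
        fun t _ => sumDensity_uniformDensity_nonneg n t
    have e := intervalIntegral.integral_add_adjacent_intervals
      (hi (a - 1) (min (a + 1) (n + 1))) (hi (min (a + 1) (n + 1)) (a + 1))
    rw [sumDensity_uniformDensity_succ]
    linarith

/-! ### Upper bound: binomial coefficients and the two-scale inequality -/

/-- The induction step reduces to `(2m + 1)(2m + 3) ≤ 4(m + 1)²`. -/
lemma centralBinom_sq_mul_le (m : ℕ) :
    (Nat.centralBinom m : ℝ) ^ 2 * (2 * m + 1) ≤ (2 ^ (2 * m)) ^ 2 := by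
  induction m with
  | zero => simp
  | succ m ih =>
    have h : ((m : ℝ) + 1) * Nat.centralBinom (m + 1) = 2 * (2 * m + 1) * Nat.centralBinom m := by
      exact_mod_cast Nat.succ_mul_centralBinom_succ m
    have hm : (0 : ℝ) ≤ m := m.cast_nonneg
    refine le_of_mul_le_mul_left (a := ((m : ℝ) + 1) ^ 2) ?_ (by positivity)
    calc ((m : ℝ) + 1) ^ 2 * ((Nat.centralBinom (m + 1) : ℝ) ^ 2 * (2 * (m + 1 : ℕ) + 1))
        = (((m : ℝ) + 1) * Nat.centralBinom (m + 1)) ^ 2 * (2 * m + 3) := by push_cast; ring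
      _ = ((Nat.centralBinom m : ℝ) ^ 2 * (2 * m + 1)) * (4 * ((2 * m + 1) * (2 * m + 3))) := by
        rw [h]; ring
      _ ≤ (2 ^ (2 * m)) ^ 2 * (16 * (m + 1) ^ 2) :=
        mul_le_mul ih (by nlinarith) (by positivity) (by positivity)
      _ = ((m : ℝ) + 1) ^ 2 * (2 ^ (2 * (m + 1))) ^ 2 := by ring

lemma choose_mul_sqrt_le (n k : ℕ) : (n.choose k : ℝ) * √(n : ℝ) ≤ 2 ^ n := by
  -- With `2 * m + 1` under the root, the estimate also serves odd `n`, where Pascal's rule costs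
  -- exactly a factor two.
  have key : ∀ m : ℕ, (Nat.centralBinom m : ℝ) * √(2 * m + 1) ≤ 2 ^ (2 * m) := fun m => by
    refine le_of_sq_le_sq ?_ (by positivity)
    rw [mul_pow, Real.sq_sqrt (by positivity)]
    exact centralBinom_sq_mul_le m
  obtain ⟨m, rfl | rfl⟩ := n.even_or_odd'
  · refine le_trans (mul_le_mul ?_ (Real.sqrt_le_sqrt ?_) (by positivity) (by positivity)) (key m)
    · exact_mod_cast Nat.choose_le_centralBinom k m
    · push_cast
      linarith
  · have h : ((2 * m + 1).choose k : ℝ) ≤ 2 * Nat.centralBinom m := by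
      cases k with
      | zero =>
        have := Nat.centralBinom_pos m
        rw [Nat.choose_zero_right]
        exact_mod_cast (by omega : 1 ≤ 2 * Nat.centralBinom m)
      | succ k =>
        have h1 := Nat.choose_le_centralBinom k m
        have h2 := Nat.choose_le_centralBinom (k + 1) m
        rw [Nat.choose_succ_succ']
        exact_mod_cast (by omega)
    calc ((2 * m + 1).choose k : ℝ) * √((2 * m + 1 : ℕ) : ℝ)
        ≤ 2 * Nat.centralBinom m * √(2 * m + 1) := by
          push_cast
          exact mul_le_mul_of_nonneg_right h (by positivity)
      _ ≤ 2 * 2 ^ (2 * m) := by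
          rw [mul_assoc]
          exact mul_le_mul_of_nonneg_left (key m) (by norm_num)
      _ = 2 ^ (2 * m + 1) := by ring

lemma intervalIntegrable_sumDensity_uniformDensity (n : ℕ) (a b : ℝ) :
    IntervalIntegrable (sumDensity uniformDensity (n + 1)) volume a b :=
  (integrable_sumDensity_uniformDensity n).intervalIntegrable

lemma intervalIntegral_sumDensity_uniformDensity_le_one (n : ℕ) {a b : ℝ} (hab : a ≤ b) :
    ∫ t in a..b, sumDensity uniformDensity (n + 1) t ≤ 1 := by
  rw [intervalIntegral.integral_of_le hab, ← integral_sumDensity_uniformDensity n]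
  exact setIntegral_le_integral (integrable_sumDensity_uniformDensity n)
    (Filter.Eventually.of_forall (sumDensity_uniformDensity_nonneg n))

/-- Sums of the density along a progression of step two telescope. -/
lemma sum_range_sumDensity_uniformDensity_le (n N : ℕ) (y : ℝ) :
    ∑ i ∈ Finset.range N, sumDensity uniformDensity (n + 2) (y + 2 * i) ≤ 1 / 2 := by
  have h : ∀ i : ℕ, sumDensity uniformDensity (n + 2) (y + 2 * i) =
      (1 / 2) * ∫ t in (y - 1 + 2 * i)..(y - 1 + 2 * (i + 1 : ℕ)),
        sumDensity uniformDensity (n + 1) t := fun i => by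
    rw [sumDensity_uniformDensity_succ]
    congr 2 <;> push_cast <;> ring
  simp_rw [h]
  rw [← Finset.mul_sum, intervalIntegral.sum_integral_adjacent_intervals
    (a := fun i : ℕ => y - 1 + 2 * (i : ℝ))
    fun i _ => intervalIntegrable_sumDensity_uniformDensity n _ _]
  refine (mul_le_mul_of_nonneg_left
    (intervalIntegral_sumDensity_uniformDensity_le_one n ?_) (by norm_num)).trans_eq (mul_one _)
  have := N.cast_nonneg (α := ℝ)
  push_cast
  linarith

/-- Dilation turns the window into one of length four, which splits into two windows of length two.
-/
lemma intervalIntegral_sumDensity_uniformDensity_dilate (n : ℕ) (x d : ℝ) :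
    ∫ t in (x - 1)..(x + 1), sumDensity uniformDensity (n + 1) (2 * t + d) =
      sumDensity uniformDensity (n + 2) (2 * x + d - 1) +
        sumDensity uniformDensity (n + 2) (2 * x + d + 1) := by
  rw [intervalIntegral.integral_comp_mul_add (sumDensity uniformDensity (n + 1)) two_ne_zero,
    sumDensity_uniformDensity_succ, sumDensity_uniformDensity_succ, ← mul_add,
    show 2 * x + d - 1 + 1 = 2 * x + d + 1 - 1 by ring,
    intervalIntegral.integral_add_adjacent_intervals
      (intervalIntegrable_sumDensity_uniformDensity n _ _)
      (intervalIntegrable_sumDensity_uniformDensity n _ _), smul_eq_mul, one_div]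
  congr 2 <;> ring

/-- The two-scale inequality: a uniform variable on `[-1, 1]` is half of the sum of another one
and an independent random sign. -/
lemma sumDensity_uniformDensity_le_sum_choose (n : ℕ) (x : ℝ) :
    sumDensity uniformDensity (n + 1) x ≤ (1 / 2) ^ n *
      ∑ ij ∈ Finset.HasAntidiagonal.antidiagonal (n + 1), ((n + 1).choose ij.1 : ℝ) *
        sumDensity uniformDensity (n + 1) (2 * x + ((ij.1 : ℝ) - ij.2)) := by
  induction n generalizing x with
  | zero =>
    have h1 := uniformDensity_nonneg (2 * x - 1)
    have h2 := uniformDensity_nonneg (2 * x + 1)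
    -- Strict only at `x = 0`, where both arguments are endpoints of the closed support.
    have : uniformDensity x ≤ uniformDensity (2 * x - 1) + uniformDensity (2 * x + 1) := by
      by_cases hx : x ∈ Set.Icc (-1 : ℝ) 1
      · rw [uniformDensity_of_mem hx]
        rcases le_total 0 x with h0 | h0
        · rw [uniformDensity_of_mem (x := 2 * x - 1) ⟨by linarith, by linarith [hx.2]⟩]
          linarith
        · rw [uniformDensity_of_mem (x := 2 * x + 1) ⟨by linarith [hx.1], by linarith⟩]
          linarith
      · rw [uniformDensity_of_notMem hx]
        linarith
    simpa [Finset.Nat.antidiagonal_succ, sumDensity, ← sub_eq_add_neg] using this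
  | succ n ih =>
    have hint : ∀ d : ℝ, IntervalIntegrable
        (fun t => sumDensity uniformDensity (n + 1) (2 * t + d)) volume (x - 1) (x + 1) :=
      fun d => (((integrable_sumDensity_uniformDensity n).comp_add_right d).comp_mul_left'
        two_ne_zero).intervalIntegrable
    have hle : ∫ t in (x - 1)..(x + 1), sumDensity uniformDensity (n + 1) t ≤
        ∫ t in (x - 1)..(x + 1), (1 / 2 : ℝ) ^ n *
          ∑ ij ∈ Finset.HasAntidiagonal.antidiagonal (n + 1), ((n + 1).choose ij.1 : ℝ) *
            sumDensity uniformDensity (n + 1) (2 * t + ((ij.1 : ℝ) - ij.2)) := by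
      refine intervalIntegral.integral_mono_on (by linarith)
        (intervalIntegrable_sumDensity_uniformDensity n _ _) ?_ fun t _ => ih t
      refine IntervalIntegrable.const_mul ?_ _
      have h := IntervalIntegrable.sum (Finset.HasAntidiagonal.antidiagonal (n + 1))
        fun ij _ => (hint ((ij.1 : ℝ) - ij.2)).const_mul ((n + 1).choose ij.1 : ℝ)
      rwa [Finset.sum_fn] at h
    rw [intervalIntegral.integral_const_mul, intervalIntegral.integral_finsetSum
      fun ij _ => (hint _).const_mul _] at hle
    simp_rw [intervalIntegral.integral_const_mul,
      intervalIntegral_sumDensity_uniformDensity_dilate] at hle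
    -- The shift by `-1` raises `j` and the shift by `+1` raises `i`, so Pascal's rule merges the
    -- two sums.
    have pascal := Finset.sum_antidiagonal_choose_succ_mul
      (fun i j => sumDensity uniformDensity (n + 2) (2 * x + ((i : ℝ) - j))) (n + 1)
    have hpascal : ∑ ij ∈ Finset.HasAntidiagonal.antidiagonal (n + 2), ((n + 2).choose ij.1 : ℝ) *
          sumDensity uniformDensity (n + 2) (2 * x + ((ij.1 : ℝ) - ij.2)) =
        ∑ ij ∈ Finset.HasAntidiagonal.antidiagonal (n + 1), ((n + 1).choose ij.1 : ℝ) *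
          (sumDensity uniformDensity (n + 2) (2 * x + ((ij.1 : ℝ) - ij.2) - 1) +
            sumDensity uniformDensity (n + 2) (2 * x + ((ij.1 : ℝ) - ij.2) + 1)) := by
      rw [pascal, ← Finset.sum_add_distrib]
      refine Finset.sum_congr rfl fun ij hij => ?_
      rw [← Nat.choose_symm_of_eq_add (Finset.HasAntidiagonal.mem_antidiagonal.1 hij).symm, mul_add]
      congr 3 <;> push_cast <;> ring
    rw [sumDensity_uniformDensity_succ]
    refine (mul_le_mul_of_nonneg_left hle (by norm_num)).trans_eq ?_
    rw [hpascal, pow_succ]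
    ring

lemma sumDensity_uniformDensity_le_inv_sqrt (n : ℕ) (x : ℝ) :
    sumDensity uniformDensity (n + 1) x ≤ 1 / √((n + 1 : ℕ) : ℝ) := by
  cases n with
  | zero =>
    refine (uniformDensity_le_half x).trans ?_
    norm_num
  | succ n =>
    have hs : 0 < √((n + 2 : ℕ) : ℝ) := Real.sqrt_pos.2 (by positivity)
    rw [le_div_iff₀ hs]
    -- Since `i + j = n + 2`, the arguments are `2x - (n + 2) + 2i`, a progression of step two.
    have hsum : ∑ ij ∈ Finset.HasAntidiagonal.antidiagonal (n + 2),
        sumDensity uniformDensity (n + 2) (2 * x + ((ij.1 : ℝ) - ij.2)) ≤ 1 / 2 := by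
      rw [Finset.Nat.sum_antidiagonal_eq_sum_range_succ_mk]
      refine le_of_eq_of_le (Finset.sum_congr rfl fun i hi => ?_)
        (sum_range_sumDensity_uniformDensity_le n (n + 3) (2 * x - (n + 2)))
      rw [Nat.cast_sub (Nat.lt_succ_iff.1 (Finset.mem_range.1 hi))]
      congr 1
      push_cast
      ring
    calc sumDensity uniformDensity (n + 2) x * √((n + 2 : ℕ) : ℝ)
        ≤ ((1 / 2) ^ (n + 1) * ∑ ij ∈ Finset.HasAntidiagonal.antidiagonal (n + 2), ((n + 2).choose ij.1 : ℝ) *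
            sumDensity uniformDensity (n + 2) (2 * x + ((ij.1 : ℝ) - ij.2))) *
              √((n + 2 : ℕ) : ℝ) :=
          mul_le_mul_of_nonneg_right (sumDensity_uniformDensity_le_sum_choose (n + 1) x) hs.le
      _ = (1 / 2) ^ (n + 1) * ∑ ij ∈ Finset.HasAntidiagonal.antidiagonal (n + 2),
            (((n + 2).choose ij.1 : ℝ) * √((n + 2 : ℕ) : ℝ)) *
            sumDensity uniformDensity (n + 2) (2 * x + ((ij.1 : ℝ) - ij.2)) := by
          rw [mul_assoc, Finset.sum_mul]
          congr 1
          exact Finset.sum_congr rfl fun _ _ => by ring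
      _ ≤ (1 / 2) ^ (n + 1) * ∑ ij ∈ Finset.HasAntidiagonal.antidiagonal (n + 2), (2 : ℝ) ^ (n + 2) *
            sumDensity uniformDensity (n + 2) (2 * x + ((ij.1 : ℝ) - ij.2)) := by
          gcongr with ij _
          · exact sumDensity_uniformDensity_nonneg (n + 1) _
          · exact choose_mul_sqrt_le (n + 2) ij.1
      _ ≤ (1 / 2) ^ (n + 1) * (2 ^ (n + 2) * (1 / 2)) := by
          rw [← Finset.mul_sum]
          gcongr
      _ = 1 := by
          rw [pow_succ (2 : ℝ) (n + 1), one_div, inv_pow]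
          field_simp

/-! ### Law of the sum of independent samples -/

/-- The iterated convolution is the density of a sum of independent uniform variables. -/
lemma map_sum_range_eq_withDensity {Ω : Type*} [MeasurableSpace Ω] {P : Measure Ω}
    [IsProbabilityMeasure P] (n : ℕ) {X : Fin (n + 1) → Ω → ℝ} (hX : ∀ i, Measurable (X i))
    (hind : iIndepFun X P)
    (hmap : ∀ i, P.map (X i) = volume.withDensity (fun x => ENNReal.ofReal (uniformDensity x))) :
    P.map (fun ω => ∑ i, X i ω) =
      volume.withDensity (fun x => ENNReal.ofReal (sumDensity uniformDensity (n + 1) x)) := by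
  induction n with
  | zero => simpa [sumDensity] using hmap 0
  | succ n ih =>
    have hrest := ih (X := fun i => X i.succ) (fun i => hX i.succ)
      (hind.precomp (Fin.succ_injective _)) fun i => hmap i.succ
    have hindep : IndepFun (X 0) (fun ω => ∑ i : Fin (n + 1), X i.succ ω) P := by
      have h := hind.indepFun_finsetSum_of_notMem hX
        (s := Finset.univ.map (Fin.succEmb (n + 1))) (i := 0) (by simp)
      have e : (∑ j ∈ Finset.univ.map (Fin.succEmb (n + 1)), X j) =
          fun ω => ∑ i : Fin (n + 1), X i.succ ω := by
        ext ω
        simp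
      rw [e] at h
      exact h.symm
    have hsum : (fun ω => ∑ i, X i ω) = X 0 + fun ω => ∑ i : Fin (n + 1), X i.succ ω := by
      ext ω
      simp [Fin.sum_univ_succ]
    rw [hsum, hindep.map_add_eq_map_conv_map (hX 0)
      (Finset.measurable_fun_sum _ fun i _ => hX i.succ), hmap 0, hrest,
      withDensity_sumDensity_uniformDensity_succ]

lemma hasDensity_sum_of_map_eq {Ω : Type u} [MeasurableSpace Ω] {P : Measure Ω}
    [IsProbabilityMeasure P] (n : ℕ) {X : Fin (n + 1) → Ω → ℝ} (hX : ∀ i, Measurable (X i))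
    (hind : iIndepFun X P)
    (hmap : ∀ i, P.map (X i) = volume.withDensity (fun x => ENNReal.ofReal (uniformDensity x))) :
    HasDensity P (fun ω => ∑ i, X i ω) (sumDensity uniformDensity (n + 1)) where
  measurable := Finset.measurable_fun_sum _ fun i _ => hX i
  isProbDensity := isProbDensity_sumDensity_uniformDensity n
  map_eq := map_sum_range_eq_withDensity n hX hind hmap

/-! ### Lower bound: the central limit theorem -/

lemma integral_uniform_withDensity :
    ∫ x, x ∂(volume.withDensity (fun x => ENNReal.ofReal (uniformDensity x))) = 0 := by
  have hu : pdf.IsUniform (fun x : ℝ => x) (Set.Icc (-1 : ℝ) 1)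
      (volume.withDensity (fun x => ENNReal.ofReal (uniformDensity x))) := by
    rw [pdf.IsUniform, withDensity_uniformDensity]
    exact Measure.map_id
  rw [hu.integral_eq, integral_Icc_eq_integral_Ioc, ← intervalIntegral.integral_of_le (by norm_num),
    integral_id]
  norm_num

lemma memLp_uniform_withDensity :
    MemLp (id : ℝ → ℝ) 2
      (volume.withDensity (fun x => ENNReal.ofReal (uniformDensity x))) := by
  have := isProbDensity_uniformDensity.isProbabilityMeasure
  refine MemLp.of_bound measurable_id.aestronglyMeasurable 1 ?_
  rw [ae_withDensity_iff measurable_uniformDensity.ennreal_ofReal]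
  refine Filter.Eventually.of_forall fun x hx => ?_
  by_contra hx1
  refine hx ?_
  rw [uniformDensity_of_notMem (x := x) fun h => hx1 (abs_le.2 h), ENNReal.ofReal_zero]

/-- Zero variance would concentrate the law at its mean `0`, but the law has no atoms. This makes
the Gaussian limit nondegenerate. -/
lemma variance_uniform_withDensity_ne_zero :
    variance (id : ℝ → ℝ)
      (volume.withDensity (fun x => ENNReal.ofReal (uniformDensity x))) ≠ 0 := by
  intro h0
  have := isProbDensity_uniformDensity.isProbabilityMeasure
  have hae := ae_eq_integral_of_variance_eq_zero memLp_uniform_withDensity h0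
  simp only [id, integral_uniform_withDensity] at hae
  have hne : ∀ᵐ x ∂(volume.withDensity (fun x => ENNReal.ofReal (uniformDensity x))), x ≠ 0 :=
    withDensity_absolutelyContinuous _ _ (Measure.ae_ne volume (0 : ℝ))
  obtain ⟨x, hx, hx0⟩ := (hae.and hne).exists
  exact hx0 hx

lemma gaussianReal_Ioo_pos {v : NNReal} (hv : v ≠ 0) {a b : ℝ} (hab : a < b) :
    0 < gaussianReal 0 v (Set.Ioo a b) := by
  rw [pos_iff_ne_zero]
  intro h
  have := gaussianReal_absolutelyContinuous' 0 hv h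
  rw [Real.volume_Ioo, ENNReal.ofReal_eq_zero] at this
  linarith

/-- On an interval to the right of the origin the density is bounded by its value at the left
endpoint, so a lower bound on probability becomes a pointwise one. -/
lemma withDensity_Ioo_le (n : ℕ) {a : ℝ} (ha : 0 ≤ a) (b : ℝ) :
    volume.withDensity (fun x => ENNReal.ofReal (sumDensity uniformDensity (n + 1) x))
        (Set.Ioo a b) ≤
      ENNReal.ofReal (sumDensity uniformDensity (n + 1) a * (b - a)) := by
  rw [withDensity_apply _ measurableSet_Ioo]
  calc ∫⁻ x in Set.Ioo a b, ENNReal.ofReal (sumDensity uniformDensity (n + 1) x)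
      ≤ ∫⁻ _ in Set.Ioo a b, ENNReal.ofReal (sumDensity uniformDensity (n + 1) a) := by
        refine setLIntegral_mono measurable_const fun x hx => ENNReal.ofReal_le_ofReal ?_
        refine sumDensity_uniformDensity_le_of_abs_le n ?_
        rw [abs_of_nonneg ha, abs_of_nonneg (ha.trans hx.1.le)]
        exact hx.1.le
    _ = _ := by
        rw [setLIntegral_const, Real.volume_Ioo,
          ENNReal.ofReal_mul (sumDensity_uniformDensity_nonneg n a)]

/-- By the central limit theorem and unimodality, the density at `√n` is eventually at least a
multiple of `1 / √n`. -/
lemma eventually_le_sumDensity_uniformDensity_mul_sqrt :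
    ∃ c : ℝ, 0 < c ∧ ∀ᶠ n : ℕ in Filter.atTop,
      c ≤ sumDensity uniformDensity n (√(n : ℝ)) * √(n : ℝ) := by
  have := isProbDensity_uniformDensity.isProbabilityMeasure
  obtain ⟨Ω, _, P, X, hX, hlaw, hind, _⟩ := exists_iid ℕ
    (volume.withDensity (fun x => ENNReal.ofReal (uniformDensity x)))
  have hmean : P[X 0] = 0 := by
    rw [← integral_uniform_withDensity, ← (hlaw 0).map_eq,
      integral_map (f := fun x : ℝ => x) (hX 0).aemeasurable measurable_id.aestronglyMeasurable]
  have hmem : MemLp (X 0) 2 P := by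
    have h := memLp_uniform_withDensity
    rw [← (hlaw 0).map_eq,
      memLp_map_measure_iff measurable_id.aestronglyMeasurable (hX 0).aemeasurable] at h
    exact h
  have hvar : Var[X 0; P].toNNReal ≠ 0 := by
    have h := variance_uniform_withDensity_ne_zero
    rw [← (hlaw 0).map_eq, variance_map measurable_id.aemeasurable (hX 0).aemeasurable] at h
    exact (Real.toNNReal_pos.2 ((variance_nonneg _ _).lt_of_ne' h)).ne'
  have hclt := tendstoInDistribution_inv_sqrt_mul_sum_sub (P := P) (X := X)
    (P' := gaussianReal 0 Var[X 0; P].toNNReal) (Y := id) HasLaw.id hmem hind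
    fun i => (hlaw i).identDistrib (hlaw 0)
  -- Portmanteau on `(1, 2)`: after rescaling by `√n`, both the left endpoint and the length are
  -- `√n`.
  have hlim := ProbabilityMeasure.le_liminf_measure_open_of_tendsto hclt.tendsto
    (isOpen_Ioo (a := (1 : ℝ)) (b := 2))
  simp only [ProbabilityMeasure.coe_mk, Measure.map_id, hmean, mul_zero, sub_zero] at hlim
  obtain ⟨d, hd0, hd⟩ := exists_between (gaussianReal_Ioo_pos hvar (one_lt_two (α := ℝ)))
  have hev := Filter.eventually_lt_of_lt_liminf (hd.trans_le hlim)
  have hdtop : d ≠ ⊤ := (hd.trans_le le_top).ne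
  refine ⟨d.toReal, ENNReal.toReal_pos hd0.ne' hdtop, ?_⟩
  filter_upwards [hev, Filter.eventually_ge_atTop 1] with n hn hn1
  obtain ⟨m, rfl⟩ := Nat.exists_eq_add_of_le' hn1
  have hs : 0 < √((m + 1 : ℕ) : ℝ) := Real.sqrt_pos.2 (by positivity)
  have hsum : P.map (fun ω => ∑ k ∈ Finset.range (m + 1), X k ω) =
      volume.withDensity
        (fun x => ENNReal.ofReal (sumDensity uniformDensity (m + 1) x)) := by
    simp_rw [Finset.sum_range]
    exact map_sum_range_eq_withDensity m (fun i => hX i)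
      (hind.precomp Fin.val_injective) fun i => (hlaw i).map_eq
  have hmeas : Measurable fun ω => ∑ k ∈ Finset.range (m + 1), X k ω :=
    Finset.measurable_fun_sum _ fun i _ => hX i
  have hset : P.map (fun ω => (√((m + 1 : ℕ) : ℝ))⁻¹ * ∑ k ∈ Finset.range (m + 1), X k ω)
        (Set.Ioo 1 2) =
      P.map (fun ω => ∑ k ∈ Finset.range (m + 1), X k ω)
        (Set.Ioo (√((m + 1 : ℕ) : ℝ)) (2 * √((m + 1 : ℕ) : ℝ))) := by
    rw [Measure.map_apply (hmeas.const_mul _) measurableSet_Ioo,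
      Measure.map_apply hmeas measurableSet_Ioo]
    congr 1
    ext ω
    simp only [Set.mem_preimage, Set.mem_Ioo, inv_mul_eq_div, one_lt_div hs, div_lt_iff₀ hs]
  rw [hset, hsum] at hn
  refine ENNReal.toReal_le_of_le_ofReal
    (mul_nonneg (sumDensity_uniformDensity_nonneg m _) hs.le)
    (hn.le.trans ((withDensity_Ioo_le m hs.le _).trans_eq ?_))
  congr 2
  ring

/-! ### Uniform constants and conclusion -/

lemma exists_pos_forall_le_of_eventually {a : ℕ → ℝ} (hpos : ∀ n, 1 ≤ n → 0 < a n)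
    (hev : ∃ c : ℝ, 0 < c ∧ ∀ᶠ n in Filter.atTop, c ≤ a n) :
    ∃ c : ℝ, 0 < c ∧ ∀ n, 1 ≤ n → c ≤ a n := by
  obtain ⟨c, hc, hev⟩ := hev
  obtain ⟨N, hN⟩ := Filter.eventually_atTop.1 hev
  have hne : (Finset.Icc 1 (N + 1)).Nonempty := ⟨1, by simp⟩
  obtain ⟨k, hk, hmin⟩ := Finset.exists_min_image (Finset.Icc 1 (N + 1)) a hne
  refine ⟨min c (a k), lt_min hc (hpos k (Finset.mem_Icc.1 hk).1), fun n hn => ?_⟩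
  rcases le_total n (N + 1) with h | h
  · exact (min_le_right _ _).trans (hmin n (Finset.mem_Icc.2 ⟨hn, h⟩))
  · exact (min_le_left _ _).trans (hN n (by omega))

lemma sumDensity_uniformDensity_sqrt_pos (n : ℕ) :
    0 < sumDensity uniformDensity (n + 1) (√((n + 1 : ℕ) : ℝ)) := by
  cases n with
  | zero =>
    -- Here `√1 = 1` is the edge of the support, so positivity relies on the interval being closed.
    change 0 < uniformDensity _
    rw [uniformDensity_of_mem (by norm_num)]
    norm_num
  | succ n =>
    refine sumDensity_uniformDensity_pos (n + 1) ?_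
    rw [abs_of_nonneg (Real.sqrt_nonneg _), Real.sqrt_lt' (by positivity)]
    push_cast
    nlinarith [n.cast_nonneg (α := ℝ)]

lemma exists_pos_forall_div_sqrt_le_sumDensity_uniformDensity :
    ∃ c : ℝ, 0 < c ∧ ∀ n : ℕ, 1 ≤ n → ∀ x ∈ Set.Icc (-√(n : ℝ)) (√(n : ℝ)),
      c / √(n : ℝ) ≤ sumDensity uniformDensity n x := by
  obtain ⟨c, hc, h⟩ := exists_pos_forall_le_of_eventually
    (a := fun n => sumDensity uniformDensity n (√(n : ℝ)) * √(n : ℝ))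
    (fun n hn => by
      obtain ⟨m, rfl⟩ := Nat.exists_eq_add_of_le' hn
      exact mul_pos (sumDensity_uniformDensity_sqrt_pos m) (Real.sqrt_pos.2 (by positivity)))
    eventually_le_sumDensity_uniformDensity_mul_sqrt
  refine ⟨c, hc, fun n hn x hx => ?_⟩
  have hs : 0 < √(n : ℝ) := Real.sqrt_pos.2 (by exact_mod_cast hn)
  refine ((div_le_iff₀ hs).2 (h n hn)).trans ?_
  obtain ⟨m, rfl⟩ := Nat.exists_eq_add_of_le' hn
  refine sumDensity_uniformDensity_le_of_abs_le m ?_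
  rw [abs_of_nonneg hs.le]
  exact abs_le.2 hx

theorem lemma2 :
    IsSumBounded.{u} uniformDensity ∧
    ∃ cl cu : ℝ, 0 < cl ∧ 0 < cu ∧ ∀ n : ℕ, 1 ≤ n →
      (∀ x ∈ Set.Icc (-√(n : ℝ)) (√(n : ℝ)),
        cl / √(n : ℝ) ≤ sumDensity uniformDensity n x) ∧
      (∀ x : ℝ, sumDensity uniformDensity n x ≤ cu / √(n : ℝ)) ∧
      (∀ (Ω : Type u) [MeasurableSpace Ω] (P : Measure Ω) [IsProbabilityMeasure P]
        (U : Fin n → Ω → ℝ), (∀ i, Measurable (U i)) → iIndepFun U P →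
        (∀ i, pdf.IsUniform (U i) (Set.Icc (-1 : ℝ) 1) P) →
          HasDensity P (fun ω => ∑ i, U i ω) (sumDensity uniformDensity n)) := by
  obtain ⟨c, hc, hlower⟩ := exists_pos_forall_div_sqrt_le_sumDensity_uniformDensity
  have hupper : ∀ n : ℕ, 1 ≤ n → ∀ x : ℝ, sumDensity uniformDensity n x ≤ 1 / √(n : ℝ) := by
    intro n hn x
    obtain ⟨m, rfl⟩ := Nat.exists_eq_add_of_le' hn
    exact sumDensity_uniformDensity_le_inv_sqrt m x
  refine ⟨⟨isProbDensity_uniformDensity, c, 1, hc, one_pos, fun n hn =>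
      ⟨hlower n hn, hupper n hn, ?_⟩⟩,
    c, 1, hc, one_pos, fun n hn => ⟨hlower n hn, hupper n hn, ?_⟩⟩
  · intro Ω _ P _ X hind hX
    obtain ⟨m, rfl⟩ := Nat.exists_eq_add_of_le' hn
    exact hasDensity_sum_of_map_eq m (fun i => (hX i).measurable) hind fun i => (hX i).map_eq
  · intro Ω _ P _ U hU hind hunif
    obtain ⟨m, rfl⟩ := Nat.exists_eq_add_of_le' hn
    exact hasDensity_sum_of_map_eq m hU hind fun i =>
      (hunif i).trans withDensity_uniformDensity.symm
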